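/- Let $S_\infty$ be the group of all permutations of $\mathbb{N}$, with the topology induced by the injection $g\mapsto g(0)g^{-1}(0)g(1)g^{-1}(1)\cdots$ into $\mathbb{N}^{\omega}$ (product of discrete spaces). For a subgroup $G\le S_\infty$ let $$T_G=\{g(0)g^{-1}(0)g(1)g^{-1}(1)\cdots g(n)g^{-1}(n) : g\in G,\ n\in\mathbb{N}\}\subseteq\mathbb{N}^{<\omega},$$ ordered by initial segments, and let $\deg(T_G)$ be the join of the Turing degree of the set $T_G$ (under a standard computable coding of finite strings) and the Turing degree of its branching function, which maps $\tau\in T_G$ to the number (possibly $\infty$) of direct successors of $\tau$ in $T_G$. A *Turing ideal* is a nonempty set $I$ of Turing degrees (of total functions $\mathbb{N}\to\mathbb{N}$) that is closed under joins and closed downwards under Turing reducibility. A degree $\boldsymbol b$ is *PA relative to* $\boldsymbol a$ if every infinite $\boldsymbol a$-computable binary tree $T\subseteq\{0,1\}^{<\omega}$ has a $\boldsymbol b$-computable path. A *Scott ideal* is a Turing ideal $I$ such that for every $\boldsymbol a\in I$ some $\boldsymbol b\in I$ is PA relative to $\boldsymbol a$. For a Turing ideal $I$ let $G_I=\{g\in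 G : \deg(g)\in I\}$, which is a subgroup of $G$. **Proposition.** Let $G$ be any subgroup of $S_\infty$ that is profinite in the subspace topology, and let $I$ be a Scott ideal with $\deg(T_G)\in I$. Then $G_I\preceq_\exists G$; that is, for every existential formula $\varphi(x_1,\dots,x_n)$ in the first-order language of groups (a block of existential quantifiers followed by a quantifier-free formula, with symbols for multiplication, inverse and identity) and all $a_1,\dots,a_n\in G_I$, $$G_I\models\varphi(a_1,\dots,a_n)\iff G\models\varphi(a_1,\dots,a_n).$$ -/

import Mathlib

namespace ScottProfinite

/-! ### Turing degrees of total functions -/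

/-- Total functions `ℕ → ℕ`, seen as oracles and preordered by Turing reducibility. -/
def Oracle : Type := ℕ → ℕ

/-- `f ≤ g` means that `f` is Turing reducible to `g`. -/
instance : Preorder Oracle where
  le f g := TuringReducible (PFun.lift (f : ℕ → ℕ)) (PFun.lift (g : ℕ → ℕ))
  le_refl _ := TuringReducible.rfl
  le_trans _ _ _ h₁ h₂ := TuringReducible.trans h₁ h₂

theorem Oracle.le_iff {f g : Oracle} :
    f ≤ g ↔ Nat.RecursiveIn {PFun.lift (g : ℕ → ℕ)} (PFun.lift (f : ℕ → ℕ)) :=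
  RecursiveIn.iff_nat

/-- Turing degrees: equivalence classes of total functions `ℕ → ℕ` under Turing equivalence. -/
abbrev Degree : Type := Antisymmetrization Oracle (· ≤ ·)

/-- The Turing degree of a total function. -/
def deg (f : ℕ → ℕ) : Degree := toAntisymmetrization (· ≤ ·) (f : Oracle)

theorem deg_le_deg {f g : ℕ → ℕ} :
    deg f ≤ deg g ↔ TuringReducible (PFun.lift f) (PFun.lift g) := Iff.rfl

/-- The join of two total functions. -/
def Oracle.join (f g : Oracle) : Oracle := fun n => Nat.pair (f n) (g n)

theorem recursiveIn_comp {O : Set (ℕ →. ℕ)} {f h : ℕ → ℕ}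
    (hf : Nat.RecursiveIn O (PFun.lift f)) (hh : Nat.RecursiveIn O (PFun.lift h)) :
    Nat.RecursiveIn O (PFun.lift fun n => f (h n)) :=
  (Nat.RecursiveIn.comp hf hh).of_eq fun _ => Part.bind_some _ _

theorem recursiveIn_pair {O : Set (ℕ →. ℕ)} {f h : ℕ → ℕ}
    (hf : Nat.RecursiveIn O (PFun.lift f)) (hh : Nat.RecursiveIn O (PFun.lift h)) :
    Nat.RecursiveIn O (PFun.lift fun n => Nat.pair (f n) (h n)) :=
  (Nat.RecursiveIn.pair hf hh).of_eq fun n => by simp [PFun.lift, Seq.seq]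

theorem Oracle.le_join_left (f g : Oracle) : f ≤ f.join g := by
  rw [Oracle.le_iff]
  have h := recursiveIn_comp (O := {PFun.lift (f.join g)}) (f := fun n => n.unpair.1)
    (h := f.join g) .left (.oracle _ (Set.mem_singleton _))
  exact h.of_eq fun n => congrArg Part.some (by simp [Oracle.join])

theorem Oracle.le_join_right (f g : Oracle) : g ≤ f.join g := by
  rw [Oracle.le_iff]
  have h := recursiveIn_comp (O := {PFun.lift (f.join g)}) (f := fun n => n.unpair.2)
    (h := f.join g) .right (.oracle _ (Set.mem_singleton _))
  exact h.of_eq fun n => congrArg Part.some (by simp [Oracle.join])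

theorem Oracle.join_le {f g h : Oracle} (hf : f ≤ h) (hg : g ≤ h) : f.join g ≤ h := by
  rw [Oracle.le_iff] at *
  exact recursiveIn_pair hf hg

/-- The Turing degrees form an upper semilattice; `a ⊔ b` is the join of `a` and `b`. -/
instance : SemilatticeSup Degree where
  sup := Quotient.map₂ Oracle.join fun _ _ h₁ _ _ h₂ =>
    ⟨Oracle.join_le (h₁.1.trans (Oracle.le_join_left _ _)) (h₂.1.trans (Oracle.le_join_right _ _)),
      Oracle.join_le (h₁.2.trans (Oracle.le_join_left _ _))
        (h₂.2.trans (Oracle.le_join_right _ _))⟩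
  le_sup_left a b := Quotient.inductionOn₂ a b fun f g => Oracle.le_join_left f g
  le_sup_right a b := Quotient.inductionOn₂ a b fun f g => Oracle.le_join_right f g
  sup_le a b c := Quotient.inductionOn₃ a b c fun _ _ _ hf hg => Oracle.join_le hf hg

open Classical in
/-- The Turing degree of a set `S` of objects coded by natural numbers: the degree of the
characteristic function of the set of codes of elements of `S`. -/
noncomputable def degSet {α : Type} [Primcodable α] (S : Set α) : Degree :=
  deg fun n => if ∃ x ∈ S, Encodable.encode x = n then 1 else 0

/-! ### Turing ideals and Scott ideals -/

/-- A Turing ideal: a nonempty set of degrees closed under joins and closed downwards. -/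
structure IsTuringIdeal (I : Set Degree) : Prop where
  nonempty : I.Nonempty
  sup_mem : ∀ a ∈ I, ∀ b ∈ I, a ⊔ b ∈ I
  mem_of_le : ∀ a ∈ I, ∀ c, c ≤ a → c ∈ I

/-- A binary tree: a set of finite binary strings closed under initial segments. -/
def IsBinaryTree (T : Set (List Bool)) : Prop :=
  ∀ τ ∈ T, ∀ σ, σ <+: τ → σ ∈ T

/-- `f` is a path through `T`: all its finite initial segments are in `T`. -/
def IsPath (T : Set (List Bool)) (f : ℕ → Bool) : Prop :=
  ∀ n, (List.range n).map f ∈ T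

/-- `b` is PA relative to `a`: every infinite `a`-computable binary tree has a
`b`-computable path. -/
def IsPARelativeTo (b a : Degree) : Prop :=
  ∀ T : Set (List Bool), IsBinaryTree T → T.Infinite → degSet T ≤ a →
    ∃ f : ℕ → Bool, IsPath T f ∧ deg (fun n => (f n).toNat) ≤ b

/-- A Scott ideal: a Turing ideal `I` such that for each `a ∈ I` some `b ∈ I` is PA relative
to `a`. -/
structure IsScottIdeal (I : Set Degree) : Prop extends IsTuringIdeal I where
  exists_pa : ∀ a ∈ I, ∃ b ∈ I, IsPARelativeTo b a

/-! ### Profinite subgroups of `S_∞` and their trees -/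

/-- The usual topology on `S_∞`, induced by `g ↦ g(0) g⁻¹(0) g(1) g⁻¹(1) ⋯` from the product
topology. -/
instance : TopologicalSpace (Equiv.Perm ℕ) :=
  TopologicalSpace.induced (fun g => fun n : ℕ => (g n, g⁻¹ n)) inferInstance

/-- A subgroup of `S_∞` is profinite if, with the subspace topology, it is isomorphic as a
topological group to a profinite group. -/
def IsProfinite (G : Subgroup (Equiv.Perm ℕ)) : Prop :=
  ∃ P : ProfiniteGrp.{0}, Nonempty (G ≃ₜ* P)

/-- The string `g(0) g⁻¹(0) g(1) g⁻¹(1) ⋯ g(n) g⁻¹(n)`. -/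
def initialString (g : Equiv.Perm ℕ) (n : ℕ) : List ℕ :=
  (List.range (n + 1)).flatMap fun k => [g k, g⁻¹ k]

/-- The tree `T_G` of all such strings for `g ∈ G`, ordered by initial segments. -/
def tree (G : Subgroup (Equiv.Perm ℕ)) : Set (List ℕ) :=
  {τ | ∃ g ∈ G, ∃ n, τ = initialString g n}

/-- The direct successors of `τ` in `T`, with respect to the initial segment order on `T`. -/
def directSuccessors (T : Set (List ℕ)) (τ : List ℕ) : Set (List ℕ) :=
  {σ ∈ T | τ <+: σ ∧ τ ≠ σ ∧ ∀ ρ ∈ T, τ <+: ρ → ρ <+: σ → ρ = τ ∨ ρ = σ}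

open Classical in
/-- The branching function of `T`, on codes: a code of `τ ∈ T` is sent to `k + 1` if `τ` has
exactly `k` direct successors in `T`, and to `0` if it has infinitely many. Numbers that are not
codes of elements of `T` are sent to `0`. -/
noncomputable def branching (T : Set (List ℕ)) : ℕ → ℕ := fun n =>
  let τ := Denumerable.ofNat (List ℕ) n
  if τ ∈ T ∧ (directSuccessors T τ).Finite then (directSuccessors T τ).ncard + 1 else 0

/-- `deg(T_G)`: the join of the degrees of the domain of `T_G` and of its branching function. -/
noncomputable def degTree (G : Subgroup (Equiv.Perm ℕ)) : Degree :=
  degSet (tree G) ⊔ deg (branching (tree G))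

/-! ### The subgroup `G_I` -/

theorem deg_one_le (f : ℕ → ℕ) : deg (fun n => (1 : Equiv.Perm ℕ) n) ≤ deg f := by
  rw [deg_le_deg, TuringReducible, RecursiveIn.iff_nat]
  exact Nat.Primrec.recursiveIn Nat.Primrec.id

theorem deg_mul_le (g h : Equiv.Perm ℕ) : deg (fun n => (g * h) n) ≤ deg g ⊔ deg h := by
  refine (Oracle.le_iff (f := fun n => (g * h) n)
    (g := Oracle.join (fun n => g n) (fun n => h n))).2 ?_
  exact recursiveIn_comp (f := fun n => g n) (h := fun n => h n)
    (Oracle.le_iff.1 (Oracle.le_join_left (fun n => g n) (fun n => h n)))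
    (Oracle.le_iff.1 (Oracle.le_join_right (fun n => g n) (fun n => h n)))

theorem deg_inv_le (g : Equiv.Perm ℕ) : deg (fun n => g⁻¹ n) ≤ deg g := by
  rw [deg_le_deg, TuringReducible, RecursiveIn.iff_nat]
  have ht : Nat.RecursiveIn {PFun.lift (g : ℕ → ℕ)}
      (PFun.lift fun p : ℕ => if p.unpair.1 = p.unpair.2 then 0 else 1) := by
    refine Nat.Primrec.recursiveIn (Primrec.nat_iff.1 ?_)
    exact Primrec.ite (Primrec.eq.comp (Primrec.fst.comp Primrec.unpair)
      (Primrec.snd.comp Primrec.unpair)) (Primrec.const 0) (Primrec.const 1)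
  have hp := recursiveIn_comp ht (recursiveIn_pair (f := fun p => p.unpair.1)
    (h := fun p => g p.unpair.2) .left (recursiveIn_comp (.oracle _ rfl) .right))
  refine hp.rfind.of_eq_tot fun n => ?_
  refine Nat.mem_rfind.2 ⟨?_, fun {m} hm => ?_⟩
  · refine (Part.mem_map_iff _).2 ⟨0, Part.mem_some_iff.2 ?_, rfl⟩
    simp
  · have : n ≠ g m := by
      rintro rfl
      simp at hm
    refine (Part.mem_map_iff _).2 ⟨1, Part.mem_some_iff.2 ?_, rfl⟩
    simp [this]

/-- `G_I`, the subgroup of `G` of all elements whose degree is in the Turing ideal `I`. -/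
def idealSubgroup (G : Subgroup (Equiv.Perm ℕ)) (I : Set Degree) (hI : IsTuringIdeal I) :
    Subgroup G where
  carrier := {g | deg ((g : Equiv.Perm ℕ) : ℕ → ℕ) ∈ I}
  mul_mem' {g h} hg hh := hI.mem_of_le _ (hI.sup_mem _ hg _ hh) _ (deg_mul_le g h)
  one_mem' := by
    obtain ⟨a, ha⟩ := hI.nonempty
    induction a using Quotient.inductionOn with
    | h f => exact hI.mem_of_le _ ha _ (deg_one_le f)
  inv_mem' {g} hg := hI.mem_of_le _ hg _ (deg_inv_le g)

/-! ### The language of groups and existential elementarity -/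

/-- The function symbols of the language of groups: multiplication, inverse and identity. -/
inductive GroupFunc : ℕ → Type
  | mul : GroupFunc 2
  | inv : GroupFunc 1
  | one : GroupFunc 0

/-- The first-order language of groups. -/
def groupLanguage : FirstOrder.Language.{0, 0} where
  Functions := GroupFunc
  Relations := fun _ => Empty

/-- Every group is a structure for the language of groups. -/
instance groupStructure (G : Type*) [Group G] : groupLanguage.Structure G where
  funMap := fun {_} f =>
    match f with
    | .mul => fun x => x 0 * x 1
    | .inv => fun x => (x 0)⁻¹
    | .one => fun _ => 1
  RelMap := fun {_} r => Empty.elim r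

/-- A subgroup, as a substructure in the language of groups. -/
def groupSubstructure {G : Type*} [Group G] (H : Subgroup G) : groupLanguage.Substructure G where
  carrier := H
  fun_mem := fun {_} f =>
    match f with
    | .mul => fun _ hx => H.mul_mem (hx 0) (hx 1)
    | .inv => fun _ hx => H.inv_mem (hx 0)
    | .one => fun _ _ => H.one_mem

/-- `A` is a `Γ`-elementary substructure of `B`: every formula in the class `Γ` has the same
truth value in `A` and in `B` at every tuple from `A`. -/
def IsElementarySubstructure {L : FirstOrder.Language.{0, 0}} {B : Type*} [L.Structure B]
    (Γ : ∀ n : ℕ, Set (L.Formula (Fin n))) (A : L.Substructure B) : Prop :=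
  ∀ (n : ℕ), ∀ φ ∈ Γ n, ∀ a : Fin n → A, φ.Realize a ↔ φ.Realize (fun i => (a i : B))

/-- The class of existential formulas: blocks of existential quantifiers followed by a
quantifier-free formula. -/
def existentialFormulas (L : FirstOrder.Language.{0, 0}) (n : ℕ) : Set (L.Formula (Fin n)) :=
  {φ | FirstOrder.Language.BoundedFormula.IsExistential φ}

end ScottProfinite

namespace ScottProfinite

open Encodable

/-! ### Closure of a Turing ideal under computable operations on coded types -/

section Computability

variable {I : Set Degree} {α β γ σ : Type} [Primcodable α] [Primcodable β] [Primcodable γ]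
  [Primcodable σ]

/-! Compactness turns the search for witnesses in `G` into the search for a path through a binary
tree. As `G` is compact, `T_G` is finitely branching and `G` consists of all permutations whose
initial strings lie on it. Since the number of successors of each node is known, some function in
`I` bounds all values `g n` with `g ∈ G` (`exists_computable_orbit_bound`). Under this bound,
totality and surjectivity of a coded graph are finite disjunctions, so the graphs of sequences from
`G` form an effectively closed class in Cantor space (`isEffectivelyClosed_graphCode`). A nonempty
class of this kind has a member in the Scott ideal (`IsEffectivelyClosed.exists_mem`).

Given a solution in `G` of a quantifier-free formula, let one coordinate of a sequence stand for the
value of each term. Products, inverses, parameters and true equations are closed conditions. The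
failure of an equation is an open one, but it is secured by prescribing the two distinct values at a
single point (`exists_family_isQF`). The resulting class contains the original solution, hence also
a sequence with all entries in `G_I`. The converse direction is the preservation of existential
formulas under embeddings. -/

theorem deg_mem_of_primrec (hI : IsTuringIdeal I) {f : ℕ → ℕ} (hf : Nat.Primrec f) :
    deg f ∈ I := by
  obtain ⟨a, ha⟩ := hI.nonempty
  induction a using Quotient.inductionOn with
  | h g => exact hI.mem_of_le _ ha _ (RecursiveIn.iff_nat.2 hf.recursiveIn)

theorem deg_mem_of_recursiveIn (hI : IsTuringIdeal I) {f g h : ℕ → ℕ} (hf : deg f ∈ I)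
    (hg : deg g ∈ I) (hh : Nat.RecursiveIn {PFun.lift f, PFun.lift g} (PFun.lift h)) :
    deg h ∈ I := by
  refine hI.mem_of_le _ (hI.sup_mem _ hf _ hg) _ ?_
  refine (Oracle.le_iff (f := h) (g := Oracle.join f g)).2 (hh.subst ?_)
  rintro k (rfl | rfl)
  · exact Oracle.le_iff.1 (Oracle.le_join_left f g)
  · exact Oracle.le_iff.1 (Oracle.le_join_right f g)

theorem deg_mem_comp (hI : IsTuringIdeal I) {f g : ℕ → ℕ} (hf : deg f ∈ I) (hg : deg g ∈ I) :
    deg (fun n => f (g n)) ∈ I :=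
  deg_mem_of_recursiveIn hI hf hg
    (recursiveIn_comp (.oracle _ (by simp)) (.oracle _ (by simp)))

theorem deg_mem_pair (hI : IsTuringIdeal I) {f g : ℕ → ℕ} (hf : deg f ∈ I) (hg : deg g ∈ I) :
    deg (fun n => Nat.pair (f n) (g n)) ∈ I :=
  deg_mem_of_recursiveIn hI hf hg
    (recursiveIn_pair (.oracle _ (by simp)) (.oracle _ (by simp)))

theorem deg_mem_rec (hI : IsTuringIdeal I) {f : ℕ → ℕ} (hf : deg f ∈ I) (b : ℕ) :
    deg (fun n => Nat.rec (motive := fun _ => ℕ) b (fun y i => f (Nat.pair y i)) n) ∈ I := by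
  refine deg_mem_of_recursiveIn hI hf hf ?_
  have h1 : Nat.RecursiveIn {PFun.lift f, PFun.lift f} (PFun.lift fun _ : ℕ => b) :=
    (Nat.Primrec.const b).recursiveIn
  have h2 : Nat.RecursiveIn {PFun.lift f, PFun.lift f} (PFun.lift fun n : ℕ => f n.unpair.2) :=
    recursiveIn_comp (.oracle _ (by simp)) .right
  -- `prec` carries a parameter; the dummy value 0 is supplied here and discarded by `h2`.
  have h3 : Nat.RecursiveIn {PFun.lift f, PFun.lift f} (PFun.lift fun n : ℕ => Nat.pair 0 n) :=
    recursiveIn_pair .zero Nat.Primrec.id.recursiveIn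
  refine ((h1.prec h2).comp h3).of_eq_tot fun n => ?_
  simp only [PFun.lift, Part.bind_eq_bind, Part.bind_some, Nat.unpair_pair]
  induction n with
  | zero => simp
  | succ n ih => exact Part.mem_bind ih (by simp)

theorem exists_deg_mem_search (hI : IsTuringIdeal I) {f : ℕ → ℕ} (hf : deg f ∈ I)
    (h : ∀ n, ∃ s, f (Nat.pair n s) = 0) :
    ∃ g : ℕ → ℕ, deg g ∈ I ∧ ∀ n, f (Nat.pair n (g n)) = 0 := by
  refine ⟨fun n => Nat.find (h n), deg_mem_of_recursiveIn hI hf hf ?_,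
    fun n => Nat.find_spec (h n)⟩
  have hf' : Nat.RecursiveIn {PFun.lift f, PFun.lift f} (PFun.lift f) := .oracle _ (by simp)
  refine hf'.rfind.of_eq_tot fun n => Nat.mem_rfind.2 ⟨?_, fun {m} hm => ?_⟩
  · exact (Part.mem_map_iff _).2 ⟨_, Part.mem_some_iff.2 rfl, by simpa using Nat.find_spec (h n)⟩
  · exact (Part.mem_map_iff _).2 ⟨_, Part.mem_some_iff.2 rfl, by simpa using Nat.find_min (h n) hm⟩

/-- A function between coded types whose action on codes has its degree in `I`. -/
def ComputableInIdeal (I : Set Degree) (f : α → σ) : Prop :=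
  deg (fun n => encode ((decode n : Option α).map f)) ∈ I

theorem computableInIdeal_nat_iff (hI : IsTuringIdeal I) {f : ℕ → ℕ} :
    ComputableInIdeal I f ↔ deg f ∈ I := by
  have h : (fun n => encode ((decode n : Option ℕ).map f)) = fun n => Nat.succ (f n) := by
    funext n; simp
  rw [ComputableInIdeal, h]
  exact ⟨fun hf => deg_mem_comp (g := fun n => Nat.succ (f n)) hI
      (deg_mem_of_primrec hI Nat.Primrec.pred) hf,
    fun hf => deg_mem_comp hI (deg_mem_of_primrec hI Nat.Primrec.succ) hf⟩

namespace ComputableInIdeal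

theorem of_primrec (hI : IsTuringIdeal I) {f : α → σ} (hf : Primrec f) :
    ComputableInIdeal I f :=
  deg_mem_of_primrec hI hf

theorem comp (hI : IsTuringIdeal I) {f : β → σ} {g : α → β} (hf : ComputableInIdeal I f)
    (hg : ComputableInIdeal I g) : ComputableInIdeal I fun a => f (g a) := by
  -- `none` has code 0 and `some z` has code `encode z + 1`. The predecessor strips the `some`; the
  -- test for 0 keeps undecodable inputs at 0, where `f` would otherwise be run on the code 0.
  have h1 : Nat.Primrec fun p : ℕ => if p.unpair.1 = 0 then 0 else p.unpair.2 :=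
    Primrec.nat_iff.1 (Primrec.ite (Primrec.eq.comp (Primrec.fst.comp Primrec.unpair)
      (Primrec.const 0)) (Primrec.const 0) (Primrec.snd.comp Primrec.unpair))
  have h2 := deg_mem_comp hI (deg_mem_of_primrec hI h1)
    (deg_mem_pair hI hg (deg_mem_comp hI hf
      (deg_mem_comp hI (deg_mem_of_primrec hI Nat.Primrec.pred) hg)))
  unfold ComputableInIdeal
  convert h2 using 3 with n
  cases (decode n : Option α) <;> simp

theorem pair (hI : IsTuringIdeal I) {f : α → β} {g : α → σ} (hf : ComputableInIdeal I f)
    (hg : ComputableInIdeal I g) : ComputableInIdeal I fun a => (f a, g a) := by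
  have h1 : Nat.Primrec fun p : ℕ => if p.unpair.1 = 0 then 0 else
      Nat.succ (Nat.pair p.unpair.1.pred p.unpair.2.pred) :=
    Primrec.nat_iff.1 (Primrec.ite (Primrec.eq.comp (Primrec.fst.comp Primrec.unpair)
      (Primrec.const 0)) (Primrec.const 0) (Primrec.succ.comp (Primrec₂.natPair.comp
        (Primrec.pred.comp (Primrec.fst.comp Primrec.unpair))
        (Primrec.pred.comp (Primrec.snd.comp Primrec.unpair)))))
  have h2 := deg_mem_comp hI (deg_mem_of_primrec hI h1) (deg_mem_pair hI hf hg)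
  unfold ComputableInIdeal
  convert h2 using 3 with n
  cases (decode n : Option α) <;> simp

theorem primrec₂_comp (hI : IsTuringIdeal I) {p : β → γ → σ} (hp : Primrec₂ p) {f : α → β}
    {g : α → γ} (hf : ComputableInIdeal I f) (hg : ComputableInIdeal I g) :
    ComputableInIdeal I fun a => p (f a) (g a) :=
  (of_primrec hI hp).comp hI (hf.pair hI hg)

theorem nat_rec (hI : IsTuringIdeal I) {f : ℕ × σ → σ} (hf : ComputableInIdeal I f) (b : σ) :
    ComputableInIdeal I fun n : ℕ => Nat.rec (motive := fun _ => σ) b (fun y i => f (y, i)) n := by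
  have h := deg_mem_comp hI (deg_mem_of_primrec hI Nat.Primrec.succ)
    (deg_mem_rec hI (deg_mem_comp hI (deg_mem_of_primrec hI Nat.Primrec.pred) hf) (encode b))
  unfold ComputableInIdeal
  convert h using 3 with n
  simp only [decode_nat, Option.map_some, encode_some]
  congr 1
  induction n with
  | zero => rfl
  | succ n ih =>
    change _ = (encode (Option.map f (decode (Nat.pair n _)))).pred
    rw [← ih, show ∀ z : σ, Nat.pair n (encode z) = encode (n, z) from fun _ => rfl, encodek]
    rfl

theorem map_range (hI : IsTuringIdeal I) {f : ℕ → σ} (hf : ComputableInIdeal I f) :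
    ComputableInIdeal I fun n => (List.range n).map f := by
  have h1 : ComputableInIdeal I fun p : ℕ × List σ => p.2 ++ [f p.1] :=
    primrec₂_comp hI Primrec.list_concat (of_primrec hI Primrec.snd)
      (hf.comp hI (of_primrec hI Primrec.fst))
  convert h1.nat_rec hI [] using 2 with n
  induction n with
  | zero => rfl
  | succ n ih => simp [List.range_succ, ih]

theorem exists_search (hI : IsTuringIdeal I) {p : ℕ × ℕ → Bool} (hp : ComputableInIdeal I p)
    (h : ∀ n, ∃ s, p (n, s) = true) :
    ∃ g : ℕ → ℕ, ComputableInIdeal I g ∧ ∀ n, p (n, g n) = true := by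
  have h1 : Primrec fun b : Bool => if b = true then 0 else 1 := Primrec.dom_bool _
  have h2 := (computableInIdeal_nat_iff hI).1 ((of_primrec hI h1).comp hI
    (hp.comp hI (of_primrec hI Primrec.unpair)))
  obtain ⟨g, hg, hg'⟩ := exists_deg_mem_search hI h2 fun n => by
    obtain ⟨s, hs⟩ := h n
    exact ⟨s, by simp [hs]⟩
  exact ⟨g, (computableInIdeal_nat_iff hI).2 hg, fun n => by simpa using hg' n⟩

end ComputableInIdeal

theorem degSet_mem (hI : IsTuringIdeal I) {S : Set α} {p : α → Bool}
    (hp : ComputableInIdeal I p) (hS : ∀ a, a ∈ S ↔ p a = true) : degSet S ∈ I := by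
  -- The number 2 is the code of `some true`. The second test is needed because a number may decode
  -- to `a` without being the code of `a`.
  have h1 : Nat.Primrec fun q : ℕ => if q.unpair.1 = 2 ∧
      encode (decode q.unpair.2 : Option α) = q.unpair.2 + 1 then 1 else 0 := by
    refine Primrec.nat_iff.1 (Primrec.ite (PrimrecPred.and ?_ ?_) (Primrec.const 1)
      (Primrec.const 0))
    · exact Primrec.eq.comp (Primrec.fst.comp Primrec.unpair) (Primrec.const 2)
    · exact Primrec.eq.comp (Primrec.encdec.comp (Primrec.snd.comp Primrec.unpair))
        (Primrec.succ.comp (Primrec.snd.comp Primrec.unpair))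
  have h2 := deg_mem_comp hI (deg_mem_of_primrec hI h1)
    (deg_mem_pair hI hp (deg_mem_of_primrec hI Nat.Primrec.id))
  unfold degSet
  convert h2 using 4 with n
  simp only [Nat.unpair_pair, id]
  constructor
  · rintro ⟨x, hx, rfl⟩
    simp [(hS x).1 hx]
  · rintro ⟨hn, hn'⟩
    cases hd : (decode n : Option α) with
    | none => simp [hd] at hn
    | some a =>
      rw [hd] at hn hn'
      refine ⟨a, (hS a).2 ?_, by simpa using hn'⟩
      cases hpa : p a
      · simp [hpa] at hn
      · rfl

end Computability

end ScottProfinite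

namespace ScottProfinite

open Encodable

/-! ### Effectively closed classes -/

section EffectivelyClosed

variable {I : Set Degree} {α : Type} [Primcodable α]

/-- A class of points of Cantor space that is defined by a sequence of clauses which is computable
in `I`. A clause is a list of literals `(v, b)`, each saying that the `v`-th bit is `b`. -/
def IsEffectivelyClosed (I : Set Degree) (S : Set (ℕ → Bool)) : Prop :=
  ∃ c : ℕ → List (ℕ × Bool), ComputableInIdeal I c ∧ ∀ X, X ∈ S ↔ ∀ n, ∃ l ∈ c n, X l.1 = l.2

theorem isEffectivelyClosed_of_clauses (hI : IsTuringIdeal I) {S : Set (ℕ → Bool)}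
    {p : α → List (ℕ × Bool)} (hp : ComputableInIdeal I p)
    (hS : ∀ X, X ∈ S ↔ ∀ a, ∃ l ∈ p a, X l.1 = l.2) : IsEffectivelyClosed I S := by
  -- Numbers that decode to nothing get a tautological clause.
  refine ⟨fun n => ((decode n : Option α).map p).getD [(0, true), (0, false)], ?_, fun X => ?_⟩
  · have h1 : Primrec fun o : Option (List (ℕ × Bool)) => o.getD [(0, true), (0, false)] :=
      Primrec.option_getD.comp Primrec.id (Primrec.const _)
    have h2 : ComputableInIdeal I fun n : ℕ => (decode n : Option α).map p := by
      convert (computableInIdeal_nat_iff hI).2 hp using 1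
      simp [ComputableInIdeal]
    exact (ComputableInIdeal.of_primrec hI h1).comp hI h2
  · rw [hS]
    constructor
    · intro h n
      cases hd : (decode n : Option α) with
      | none => cases hX : X 0 <;> simp [hd, hX]
      | some a => simpa [hd] using h a
    · intro h a
      simpa using h (encode a)

theorem IsEffectivelyClosed.inter (hI : IsTuringIdeal I) {S T : Set (ℕ → Bool)}
    (hS : IsEffectivelyClosed I S) (hT : IsEffectivelyClosed I T) :
    IsEffectivelyClosed I (S ∩ T) := by
  obtain ⟨c, hc, hc'⟩ := hS
  obtain ⟨d, hd, hd'⟩ := hT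
  have h1 : Primrec₂ fun (b : Bool) (q : List (ℕ × Bool) × List (ℕ × Bool)) =>
      bif b then q.1 else q.2 :=
    Primrec.cond Primrec.fst (Primrec.fst.comp Primrec.snd) (Primrec.snd.comp Primrec.snd)
  have h2 : ComputableInIdeal I fun q : Bool × ℕ => bif q.1 then c q.2 else d q.2 :=
    .primrec₂_comp hI h1 (.of_primrec hI Primrec.fst)
      (.pair hI (hc.comp hI (.of_primrec hI Primrec.snd))
        (hd.comp hI (.of_primrec hI Primrec.snd)))
  refine isEffectivelyClosed_of_clauses hI h2 fun X => ?_
  simp [hc', hd', Prod.forall, Bool.forall_bool, and_comm]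

theorem isEffectivelyClosed_univ (hI : IsTuringIdeal I) :
    IsEffectivelyClosed I Set.univ := by
  refine isEffectivelyClosed_of_clauses (α := ℕ) hI
    (.of_primrec hI (Primrec.const [(0, true), (0, false)])) fun X => ?_
  cases hX : X 0 <;> simp [hX]

/-- A literal about a bit beyond the end of `σ` counts as not refuted, which makes the tree built
from this relation closed under initial segments. -/
theorem primrecRel_not_refuted : PrimrecRel fun (cl : List (ℕ × Bool)) (σ : List Bool) =>
    ∃ l ∈ cl, ¬ σ[l.1]? = some (!l.2) := by
  apply PrimrecRel.exists_mem_list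
  refine PrimrecPred.not ?_
  exact Primrec.eq.comp (Primrec.list_getElem?.comp Primrec.snd (Primrec.fst.comp Primrec.fst))
    (Primrec.option_some.comp ((Primrec.dom_bool not).comp (Primrec.snd.comp Primrec.fst)))

/-- The degrees of a Scott ideal form a basis for effectively closed classes. -/
theorem IsEffectivelyClosed.exists_mem (hI : IsScottIdeal I) {S : Set (ℕ → Bool)}
    (hS : IsEffectivelyClosed I S) (hne : S.Nonempty) :
    ∃ X ∈ S, ComputableInIdeal I X := by
  have hI' := hI.toIsTuringIdeal
  obtain ⟨c, hc, hcS⟩ := hS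
  -- A string of length `k` is tested against the first `k` clauses only, so membership is decidable
  -- in `I`.
  let T : Set (List Bool) :=
    {σ | ∀ cl ∈ (List.range σ.length).map c, ∃ l ∈ cl, ¬ σ[l.1]? = some (!l.2)}
  have hT : IsBinaryTree T := by
    intro τ hτ σ hσ cl hcl
    obtain ⟨ρ, rfl⟩ := hσ
    have hcl' : cl ∈ (List.range (σ ++ ρ).length).map c := by
      simp only [List.mem_map, List.mem_range, List.length_append] at hcl ⊢
      obtain ⟨j, hj, rfl⟩ := hcl
      exact ⟨j, by omega, rfl⟩
    obtain ⟨l, hl, hl'⟩ := hτ cl hcl'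
    refine ⟨l, hl, fun h => hl' ?_⟩
    rw [List.getElem?_append_left (List.getElem?_eq_some_iff.1 h).1, h]
  have hinf : T.Infinite := by
    obtain ⟨X, hX⟩ := hne
    refine Set.infinite_of_injective_forall_mem (f := fun n => (List.range n).map X)
      (fun m n h => by simpa using congrArg List.length h) fun n cl hcl => ?_
    simp only [List.mem_map] at hcl
    obtain ⟨j, -, rfl⟩ := hcl
    obtain ⟨l, hl, hl'⟩ := (hcS X).1 hX j
    refine ⟨l, hl, fun h => ?_⟩
    simp only [List.getElem?_map, Option.map_eq_some_iff] at h
    obtain ⟨k, hk, hk'⟩ := h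
    obtain ⟨hk1, rfl⟩ := List.getElem?_eq_some_iff.1 hk
    simp [hl'] at hk'
  have hdeg : degSet T ∈ I := by
    obtain ⟨_, hp⟩ := primrecRel_not_refuted.forall_mem_list
    have h1 : ComputableInIdeal I fun σ : List Bool => (List.range σ.length).map c :=
      (hc.map_range hI').comp hI' (.of_primrec hI' Primrec.list_length)
    exact degSet_mem hI' ((ComputableInIdeal.of_primrec hI' hp).comp hI'
      (h1.pair hI' (.of_primrec hI' Primrec.id))) fun σ => by simp [T]
  obtain ⟨b, hb, hPA⟩ := hI.exists_pa _ hdeg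
  obtain ⟨X, hXT, hXb⟩ := hPA T hT hinf le_rfl
  refine ⟨X, (hcS X).2 fun n => ?_, ?_⟩
  · by_contra! hcon
    -- The initial segment of length `n + 1 + N` is tested against clause `n` and decides all its
    -- literals.
    obtain ⟨N, hN⟩ : ∃ N, ∀ l ∈ c n, l.1 < N :=
      ⟨((c n).map Prod.fst).sum + 1, fun l hl =>
        Nat.lt_succ_of_le (List.single_le_sum (by simp) _ (List.mem_map_of_mem hl))⟩
    obtain ⟨l, hl, hl'⟩ := hXT (n + 1 + N) (c n) (List.mem_map_of_mem (by simp; omega))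
    refine hl' ?_
    have hlN := hN l hl
    have := hcon l hl
    rw [List.getElem?_map, List.getElem?_range (by omega)]
    cases hX : X l.1 <;> cases hl2 : l.2 <;> simp_all
  · have h1 : Primrec fun n : ℕ => decide (n = 1) :=
      (Primrec.eq.comp Primrec.id (Primrec.const 1)).decide
    have h2 := (ComputableInIdeal.of_primrec hI' h1).comp hI'
      ((computableInIdeal_nat_iff hI').2 (hI'.mem_of_le _ hb _ hXb))
    convert h2 using 2 with n
    cases X n <;> rfl

end EffectivelyClosed

end ScottProfinite

namespace ScottProfinite

open Encodable Filter Topology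

/-! ### Compact subgroups of `S_∞` -/

theorem continuous_apply_inv_apply :
    Continuous fun g : Equiv.Perm ℕ => fun n : ℕ => (g n, g⁻¹ n) :=
  continuous_induced_dom

instance : T2Space (Equiv.Perm ℕ) :=
  T2Space.of_injective_continuous
    (fun _ _ h => Equiv.ext fun n => (Prod.ext_iff.1 (congrFun h n)).1) continuous_apply_inv_apply

theorem IsProfinite.isCompact {G : Subgroup (Equiv.Perm ℕ)} (hG : IsProfinite G) :
    IsCompact (G : Set (Equiv.Perm ℕ)) := by
  obtain ⟨P, ⟨e⟩⟩ := hG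
  have : CompactSpace G := e.symm.toHomeomorph.compactSpace
  exact isCompact_iff_compactSpace.2 this

theorem length_initialString (g : Equiv.Perm ℕ) (n : ℕ) :
    (initialString g n).length = 2 * (n + 1) := by
  simp [initialString, mul_comm]

theorem initialString_prefix (g : Equiv.Perm ℕ) {m n : ℕ} (h : m ≤ n) :
    initialString g m <+: initialString g n := by
  obtain ⟨k, rfl⟩ := Nat.exists_eq_add_of_le h
  rw [initialString, initialString, show m + k + 1 = (m + 1) + k by omega, List.range_add (n := m + 1) (m := k),
    List.flatMap_append]
  exact List.prefix_append _ _

theorem initialString_eq_iff {g h : Equiv.Perm ℕ} {n : ℕ} :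
    initialString g n = initialString h n ↔ ∀ k ≤ n, g k = h k ∧ g⁻¹ k = h⁻¹ k := by
  induction n with
  | zero => simp [initialString]
  | succ n ih =>
    have key (g : Equiv.Perm ℕ) : initialString g (n + 1) =
        initialString g n ++ [g (n + 1), g⁻¹ (n + 1)] := by
      rw [initialString, List.range_succ, List.flatMap_append]
      simp [initialString]
    rw [key, key, List.append_eq_append_iff_of_size_eq_left (by simp [length_initialString]), ih]
    simp only [Nat.le_succ_iff_eq_or_le]
    aesop

/-- Elements of `G` agreeing with `y` on longer and longer strings converge to `y`, and a compact
subset of a Hausdorff space is closed. -/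
theorem mem_of_initialString_mem_tree {G : Subgroup (Equiv.Perm ℕ)}
    (hG : IsCompact (G : Set (Equiv.Perm ℕ))) {y : Equiv.Perm ℕ}
    (h : ∀ n, initialString y n ∈ tree G) : y ∈ G := by
  have h' (n : ℕ) : ∃ g ∈ G, initialString g n = initialString y n := by
    obtain ⟨g, hg, m, hm⟩ := h n
    have := congrArg List.length hm
    simp only [length_initialString] at this
    obtain rfl : n = m := by omega
    exact ⟨g, hg, hm.symm⟩
  choose g hg hgy using h'
  refine hG.isClosed.mem_of_tendsto (f := g) (b := atTop) ?_ (Eventually.of_forall hg)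
  rw [nhds_induced, tendsto_comap_iff, tendsto_pi_nhds]
  intro k
  refine tendsto_nhds_of_eventually_eq ((eventually_ge_atTop k).mono fun n hn => ?_)
  obtain ⟨h1, h2⟩ := initialString_eq_iff.1 (hgy n) k hn
  exact Prod.ext h1 h2

/-- The string depends continuously on `g` and takes values in a discrete space, where compact sets
are finite. -/
theorem finite_range_initialString {G : Subgroup (Equiv.Perm ℕ)}
    (hG : IsCompact (G : Set (Equiv.Perm ℕ))) (n : ℕ) :
    ((fun g => initialString g n) '' (G : Set (Equiv.Perm ℕ))).Finite := by
  have hc : Continuous fun g : Equiv.Perm ℕ => fun k : Fin (n + 1) => (g k, g⁻¹ k) :=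
    continuous_pi fun k => (continuous_apply (k : ℕ)).comp continuous_apply_inv_apply
  have hf := (hG.image hc).finite_of_discrete
  refine (hf.image fun (w : Fin (n + 1) → ℕ × ℕ) =>
    (List.finRange (n + 1)).flatMap fun k => [(w k).1, (w k).2]).subset ?_
  rintro _ ⟨g, hg, rfl⟩
  refine ⟨_, ⟨g, hg, rfl⟩, ?_⟩
  simp [initialString, ← List.map_coe_finRange_eq_range, List.flatMap_map]

theorem finite_tree_length_le {G : Subgroup (Equiv.Perm ℕ)}
    (hG : IsCompact (G : Set (Equiv.Perm ℕ))) (N : ℕ) :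
    {τ ∈ tree G | τ.length ≤ N}.Finite := by
  refine ((Set.finite_Iic N).biUnion fun n _ => finite_range_initialString hG n).subset ?_
  rintro _ ⟨⟨g, hg, n, rfl⟩, hn⟩
  rw [length_initialString] at hn
  exact Set.mem_biUnion (show n ∈ Set.Iic N by simp; omega) ⟨g, hg, rfl⟩

/-- Each level contributes the two entries `g k` and `g⁻¹ k`, so all nodes have even length and none
is skipped between consecutive levels. -/
theorem directSuccessors_tree {G : Subgroup (Equiv.Perm ℕ)} {τ : List ℕ} (hτ : τ ∈ tree G) :
    directSuccessors (tree G) τ =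
      {σ ∈ tree G | τ <+: σ ∧ σ.length = τ.length + 2} := by
  obtain ⟨g, hg, k, rfl⟩ := hτ
  ext σ
  simp only [directSuccessors, Set.mem_ofPred_eq, length_initialString]
  refine and_congr_right fun hσ => and_congr_right fun hpre => ?_
  obtain ⟨g', hg', n, rfl⟩ := hσ
  constructor
  · rintro ⟨hne, hmin⟩
    have hle := hpre.length_le
    simp only [length_initialString] at hle ⊢
    have hkn : k < n := by
      rcases lt_or_eq_of_le (show k ≤ n by omega) with h | rfl
      · exact h
      · exact absurd (hpre.eq_of_length (by simp [length_initialString])) hne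
    have h1 := initialString_prefix g' hkn
    rcases hmin (initialString g' (k + 1)) ⟨g', hg', _, rfl⟩
      (List.prefix_of_prefix_length_le hpre h1 (by simp [length_initialString])) h1 with h | h <;>
    · have := congrArg List.length h
      simp only [length_initialString] at this
      omega
  · intro hlen
    simp only [length_initialString] at hlen
    refine ⟨fun h => ?_, ?_⟩
    · have := congrArg List.length h
      simp only [length_initialString] at this
      omega
    · rintro ρ ⟨g'', hg'', m, rfl⟩ h1 h2
      have hl1 := h1.length_le
      have hl2 := h2.length_le
      simp only [length_initialString] at hl1 hl2
      rcases (show m = k ∨ m = n by omega) with rfl | rfl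
      · exact .inl (h1.eq_of_length (by simp [length_initialString])).symm
      · exact .inr (h2.eq_of_length (by simp [length_initialString]))

theorem finite_directSuccessors {G : Subgroup (Equiv.Perm ℕ)}
    (hG : IsCompact (G : Set (Equiv.Perm ℕ))) {τ : List ℕ} (hτ : τ ∈ tree G) :
    (directSuccessors (tree G) τ).Finite := by
  rw [directSuccessors_tree hτ]
  exact (finite_tree_length_le hG (τ.length + 2)).subset fun σ hσ => ⟨hσ.1, hσ.2.2.le⟩

theorem branching_encode {G : Subgroup (Equiv.Perm ℕ)}
    (hG : IsCompact (G : Set (Equiv.Perm ℕ))) {τ : List ℕ} (hτ : τ ∈ tree G) :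
    branching (tree G) (encode τ) = (directSuccessors (tree G) τ).ncard + 1 := by
  simp [branching, Denumerable.ofNat_encode, hτ, finite_directSuccessors hG hτ]

/-- No node branches infinitely, so the value 0 is left for non-nodes and the branching function
alone decides the tree. -/
theorem branching_encode_eq_zero_iff {G : Subgroup (Equiv.Perm ℕ)}
    (hG : IsCompact (G : Set (Equiv.Perm ℕ))) {τ : List ℕ} :
    branching (tree G) (encode τ) = 0 ↔ τ ∉ tree G := by
  by_cases hτ : τ ∈ tree G
  · simp [branching_encode hG hτ, hτ]
  · simp [branching, Denumerable.ofNat_encode, hτ]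

theorem le_encode_of_mem {l : List ℕ} {a : ℕ} (h : a ∈ l) : a ≤ encode l := by
  induction l with
  | nil => simp at h
  | cons b l ih =>
    rw [encode_list_cons]
    rcases List.mem_cons.1 h with rfl | h
    · exact (Nat.left_le_pair _ _).trans (Nat.le_succ _)
    · exact (ih h).trans ((Nat.right_le_pair _ _).trans (Nat.le_succ _))

/-! ### An effective bound for the orbits -/

/-- The string `σ` extends `τ` by two entries and `B` gives a nonzero value to its code `c`. -/
def IsListedSuccessor (c : ℕ) (q : List ℕ × List ℕ) : Prop :=
  q.2.getD c 0 ≠ 0 ∧ (Denumerable.ofNat (List ℕ) c).take q.1.length = q.1 ∧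
    (Denumerable.ofNat (List ℕ) c).length = q.1.length + 2

instance : DecidableRel IsListedSuccessor := fun _ _ => by
  unfold IsListedSuccessor; infer_instance

/-- `B` lists all the successors that it should for the string with code `c`, up to length `n`. -/
def IsSaturatedAt (c : ℕ) (q : ℕ × List ℕ) : Prop :=
  q.2.getD c 0 = 0 ∨ 2 * q.1 < (Denumerable.ofNat (List ℕ) c).length ∨
    ((List.range q.2.length).filter fun d =>
      IsListedSuccessor d (Denumerable.ofNat (List ℕ) c, q.2)).length + 1 = q.2.getD c 0

instance : DecidableRel IsSaturatedAt := fun _ _ => by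
  unfold IsSaturatedAt; infer_instance

theorem primrec_ofNat_list : Primrec (Denumerable.ofNat (List ℕ)) :=
  Primrec.ofNat (List ℕ)

theorem primrecRel_isListedSuccessor : PrimrecRel IsListedSuccessor := by
  have h1 : Primrec fun p : ℕ × List ℕ × List ℕ => Denumerable.ofNat (List ℕ) p.1 :=
    primrec_ofNat_list.comp Primrec.fst
  have h2 : Primrec fun p : ℕ × List ℕ × List ℕ => p.2.1 := Primrec.fst.comp Primrec.snd
  refine PrimrecPred.and (PrimrecPred.not ?_) (PrimrecPred.and ?_ ?_)
  · exact Primrec.eq.comp ((Primrec.list_getD 0).comp (Primrec.snd.comp Primrec.snd) Primrec.fst)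
      (Primrec.const 0)
  · exact Primrec.eq.comp (Primrec.list_take.comp (Primrec.list_length.comp h2) h1) h2
  · exact Primrec.eq.comp (Primrec.list_length.comp h1)
      (Primrec.nat_add.comp (Primrec.list_length.comp h2) (Primrec.const 2))

theorem primrecRel_isSaturatedAt : PrimrecRel IsSaturatedAt := by
  have h1 : Primrec fun p : ℕ × ℕ × List ℕ => Denumerable.ofNat (List ℕ) p.1 :=
    primrec_ofNat_list.comp Primrec.fst
  have h2 : Primrec fun p : ℕ × ℕ × List ℕ => p.2.2 := Primrec.snd.comp Primrec.snd
  have h3 : Primrec fun p : ℕ × ℕ × List ℕ => p.2.2.getD p.1 0 :=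
    (Primrec.list_getD 0).comp h2 Primrec.fst
  refine PrimrecPred.or ?_ (PrimrecPred.or ?_ ?_)
  · exact Primrec.eq.comp h3 (Primrec.const 0)
  · exact Primrec.nat_lt.comp
      (Primrec.nat_mul.comp (Primrec.const 2) (Primrec.fst.comp Primrec.snd))
      (Primrec.list_length.comp h1)
  · exact Primrec.eq.comp (Primrec.succ.comp (Primrec.list_length.comp
      (primrecRel_isListedSuccessor.listFilter.comp
        (Primrec.list_range.comp (Primrec.list_length.comp h2)) (h1.pair h2)))) h3

theorem getD_map_range (f : ℕ → ℕ) (s c : ℕ) :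
    ((List.range s).map f).getD c 0 = if c < s then f c else 0 := by
  split_ifs with h <;> simp [h]

theorem isListedSuccessor_map_range_iff {G : Subgroup (Equiv.Perm ℕ)}
    (hG : IsCompact (G : Set (Equiv.Perm ℕ))) {τ : List ℕ} (hτ : τ ∈ tree G) (s d : ℕ) :
    IsListedSuccessor d (τ, (List.range s).map (branching (tree G))) ↔
      d < s ∧ d ∈ encode '' directSuccessors (tree G) τ := by
  obtain ⟨σ, rfl⟩ : ∃ σ : List ℕ, encode σ = d := ⟨_, Denumerable.encode_ofNat d⟩
  rw [Encodable.encode_injective.mem_set_image, directSuccessors_tree hτ, IsListedSuccessor,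
    getD_map_range, Denumerable.ofNat_encode]
  have h : (branching (tree G) (encode σ) ≠ 0) ↔ σ ∈ tree G := by
    rw [Ne, branching_encode_eq_zero_iff hG, not_not]
  simp only [Set.mem_ofPred_eq, List.prefix_iff_eq_take (l₁ := τ), ← h, eq_comm (a := τ)]
  split_ifs with hs <;> simp [hs]

/-- The number of successors is finite and known, so counting those with code below `s` reveals
whether any is missing. -/
theorem isSaturatedAt_map_range_iff {G : Subgroup (Equiv.Perm ℕ)}
    (hG : IsCompact (G : Set (Equiv.Perm ℕ))) {τ : List ℕ} (hτ : τ ∈ tree G) {n s : ℕ}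
    (hs : encode τ < s) (hn : τ.length ≤ 2 * n) :
    IsSaturatedAt (encode τ) (n, (List.range s).map (branching (tree G))) ↔
      ∀ σ ∈ directSuccessors (tree G) τ, encode σ < s := by
  have hfin := (finite_directSuccessors hG hτ).image encode
  have hcard : ((List.range s).filter fun d =>
      IsListedSuccessor d (τ, (List.range s).map (branching (tree G)))).length =
      (encode '' directSuccessors (tree G) τ ∩ Set.Iio s).ncard := by
    rw [← List.toFinset_card_of_nodup (List.nodup_range.filter _), ← Set.ncard_coe_finset]
    congr 1
    ext d
    simp [isListedSuccessor_map_range_iff hG hτ]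
    tauto
  have h0 : branching (tree G) (encode τ) ≠ 0 := by
    rw [Ne, branching_encode_eq_zero_iff hG, not_not]; exact hτ
  simp only [IsSaturatedAt, getD_map_range, Denumerable.ofNat_encode, hs, if_true, h0,
    hn.not_gt, false_or, List.length_map, List.length_range]
  rw [hcard, branching_encode hG hτ,
    ← Set.ncard_image_of_injective (directSuccessors (tree G) τ) encode_injective,
    Nat.add_right_cancel_iff]
  constructor
  · intro h σ hσ
    have := Set.eq_of_subset_of_ncard_le Set.inter_subset_left h.ge hfin
    exact (this.ge (Set.mem_image_of_mem _ hσ)).2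
  · intro h
    congr 1
    refine Set.inter_eq_left.2 ?_
    rintro _ ⟨σ, hσ, rfl⟩
    exact h σ hσ

/-- Search for a table of the branching function that contains all successors of its own nodes up to
the required level. Starting from the roots, such a table contains every node up to that level, and
the code of a string bounds its entries. -/
theorem exists_computable_orbit_bound {G : Subgroup (Equiv.Perm ℕ)}
    (hG : IsCompact (G : Set (Equiv.Perm ℕ))) {I : Set Degree} (hI : IsTuringIdeal I)
    (hbr : ComputableInIdeal I (branching (tree G))) :
    ∃ h : ℕ → ℕ, ComputableInIdeal I h ∧ ∀ g ∈ G, ∀ n, g n ≤ h n := by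
  -- The empty string is not in the tree; its minimal nodes have length 2.
  obtain ⟨s₀, hs₀⟩ : ∃ s₀, ∀ τ ∈ tree G, τ.length ≤ 2 → encode τ < s₀ := by
    obtain ⟨b, hb⟩ := ((finite_tree_length_le hG 2).image encode).bddAbove
    exact ⟨b + 1, fun τ hτ hl => Nat.lt_succ_of_le (hb ⟨τ, ⟨hτ, hl⟩, rfl⟩)⟩
  obtain ⟨_, hsat⟩ := primrecRel_isSaturatedAt.forall_mem_list
  have hp : ComputableInIdeal I fun q : ℕ × ℕ => decide (∀ c ∈ List.range (s₀ + q.2),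
      IsSaturatedAt c (q.1, (List.range (s₀ + q.2)).map (branching (tree G)))) := by
    have h1 : Primrec fun q : ℕ × ℕ => s₀ + q.2 :=
      Primrec.nat_add.comp (Primrec.const s₀) Primrec.snd
    convert (ComputableInIdeal.of_primrec hI hsat).comp hI
      ((ComputableInIdeal.of_primrec hI (Primrec.list_range.comp h1)).pair hI ((ComputableInIdeal.of_primrec hI
        Primrec.fst).pair hI ((hbr.map_range hI).comp hI (.of_primrec hI h1))))
  obtain ⟨h, hh, hh'⟩ := hp.exists_search hI fun n => by
    -- The search stops: only finitely many nodes have length at most `2 * n + 2`, the length of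
    -- successors of the nodes tested.
    obtain ⟨b, hb⟩ := ((finite_tree_length_le hG (2 * n + 2)).image encode).bddAbove
    refine ⟨b + 1, decide_eq_true fun c hc => ?_⟩
    rw [List.mem_range] at hc
    obtain ⟨τ, rfl⟩ : ∃ τ : List ℕ, encode τ = c := ⟨_, Denumerable.encode_ofNat c⟩
    by_cases hτ : τ ∈ tree G
    · by_cases hn : τ.length ≤ 2 * n
      · refine (isSaturatedAt_map_range_iff hG hτ hc hn).2 fun σ hσ => ?_
        rw [directSuccessors_tree hτ] at hσ
        have := hb ⟨σ, ⟨hσ.1, by rw [hσ.2.2]; omega⟩, rfl⟩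
        omega
      · exact .inr (.inl (by simpa [Denumerable.ofNat_encode] using hn))
    · left
      rw [getD_map_range, (branching_encode_eq_zero_iff hG).2 hτ, ite_self]
  refine ⟨fun n => s₀ + h n, ?_, fun g hg n => ?_⟩
  · exact (ComputableInIdeal.of_primrec hI
      (Primrec.nat_add.comp (Primrec.const s₀) Primrec.id)).comp hI hh
  · have hsat' := of_decide_eq_true (hh' n)
    have key (k : ℕ) (hk : k ≤ n) : encode (initialString g k) < s₀ + h n := by
      induction k with
      | zero =>
        exact (hs₀ _ ⟨g, hg, 0, rfl⟩ (by simp [length_initialString])).trans_le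
          (Nat.le_add_right _ _)
      | succ k ih =>
        have ih' := ih (by omega)
        refine (isSaturatedAt_map_range_iff hG ⟨g, hg, k, rfl⟩ ih'
          (by rw [length_initialString]; omega)).1 (hsat' _ (List.mem_range.2 ih')) _ ?_
        rw [directSuccessors_tree ⟨g, hg, k, rfl⟩]
        exact ⟨⟨g, hg, _, rfl⟩, initialString_prefix g (Nat.le_succ k),
          by simp only [length_initialString]; omega⟩
    refine (le_encode_of_mem ?_).trans (key n le_rfl).le
    exact List.mem_flatMap.2 ⟨n, by simp, by simp⟩

end ScottProfinite

namespace ScottProfinite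

open Encodable

/-! ### Families of permutations as points of Cantor space -/

/-- The bit which says that the `i`-th permutation sends `n` to `m`. -/
def graphBit (i n m : ℕ) : ℕ := Nat.pair i (Nat.pair n m)

/-- The point of Cantor space that codes the graphs of a sequence of permutations. -/
def graphCode (y : ℕ → Equiv.Perm ℕ) (v : ℕ) : Bool :=
  decide (y v.unpair.1 v.unpair.2.unpair.1 = v.unpair.2.unpair.2)

@[simp] theorem graphCode_graphBit (y : ℕ → Equiv.Perm ℕ) (i n m : ℕ) :
    graphCode y (graphBit i n m) = decide (y i n = m) := by
  simp [graphCode, graphBit]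

theorem eq_graphCode_iff {X : ℕ → Bool} {y : ℕ → Equiv.Perm ℕ} :
    X = graphCode y ↔ ∀ i n m, X (graphBit i n m) = true ↔ y i n = m := by
  constructor
  · rintro rfl i n m
    simp
  · intro h
    funext v
    have := h v.unpair.1 v.unpair.2.unpair.1 v.unpair.2.unpair.2
    rw [graphBit, Nat.pair_unpair, Nat.pair_unpair] at this
    rw [Bool.eq_iff_iff, this, graphCode, decide_eq_true_iff]

theorem primrec_graphBit {α : Type} [Primcodable α] {f g h : α → ℕ} (hf : Primrec f)
    (hg : Primrec g) (hh : Primrec h) : Primrec fun a => graphBit (f a) (g a) (h a) :=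
  Primrec₂.natPair.comp hf (Primrec₂.natPair.comp hg hh)

theorem primrec_pair_const {α : Type} [Primcodable α] {f : α → ℕ} (hf : Primrec f) (b : Bool) :
    Primrec fun a => (f a, b) :=
  hf.pair (Primrec.const b)

theorem primrec_list_singleton {α β : Type} [Primcodable α] [Primcodable β] {f : α → β}
    (hf : Primrec f) : Primrec fun a => [f a] :=
  Primrec.list_cons.comp hf (Primrec.const [])

section

variable {I : Set Degree}

/-- The bound `h` makes each existence statement a finite clause. -/
theorem isEffectivelyClosed_total (hI : IsTuringIdeal I) {h : ℕ → ℕ}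
    (hh : ComputableInIdeal I h) :
    IsEffectivelyClosed I {X | ∀ i n, ∃ m ≤ h n, X (graphBit i n m) = true} := by
  have h1 : Primrec₂ fun (q : ℕ × ℕ) (b : ℕ) =>
      (List.range (b + 1)).map fun m => (graphBit q.1 q.2 m, true) :=
    Primrec.list_map (Primrec.list_range.comp (Primrec.succ.comp Primrec.snd))
      (primrec_pair_const (primrec_graphBit (Primrec.fst.comp (Primrec.fst.comp Primrec.fst))
        (Primrec.snd.comp (Primrec.fst.comp Primrec.fst)) Primrec.snd) true)
  refine isEffectivelyClosed_of_clauses hI (.primrec₂_comp hI h1 (.of_primrec hI Primrec.id)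
    (hh.comp hI (.of_primrec hI Primrec.snd))) fun X => ?_
  simp

theorem isEffectivelyClosed_surjective (hI : IsTuringIdeal I) {h : ℕ → ℕ}
    (hh : ComputableInIdeal I h) :
    IsEffectivelyClosed I {X | ∀ i n, ∃ m ≤ h n, X (graphBit i m n) = true} := by
  have h1 : Primrec₂ fun (q : ℕ × ℕ) (b : ℕ) =>
      (List.range (b + 1)).map fun m => (graphBit q.1 m q.2, true) :=
    Primrec.list_map (Primrec.list_range.comp (Primrec.succ.comp Primrec.snd))
      (primrec_pair_const (primrec_graphBit (Primrec.fst.comp (Primrec.fst.comp Primrec.fst))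
        Primrec.snd (Primrec.snd.comp (Primrec.fst.comp Primrec.fst))) true)
  refine isEffectivelyClosed_of_clauses hI (.primrec₂_comp hI h1 (.of_primrec hI Primrec.id)
    (hh.comp hI (.of_primrec hI Primrec.snd))) fun X => ?_
  simp

theorem isEffectivelyClosed_of_ite (hI : IsTuringIdeal I) {α : Type} [Primcodable α]
    {P : α → Prop} [DecidablePred P] (hP : ComputableInIdeal I fun a => decide (P a))
    {p : α → List (ℕ × Bool)} (hp : ComputableInIdeal I p) :
    IsEffectivelyClosed I {X | ∀ a, P a → ∃ l ∈ p a, X l.1 = l.2} := by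
  have h1 : Primrec₂ fun (b : Bool) (l : List (ℕ × Bool)) =>
      bif b then l else [(0, true), (0, false)] :=
    Primrec.cond Primrec.fst Primrec.snd (Primrec.const _)
  refine isEffectivelyClosed_of_clauses hI (.primrec₂_comp hI h1 hP hp) fun X => ?_
  refine forall_congr' fun a => ?_
  by_cases ha : P a
  · simp [ha]
  · cases hX : X 0 <;> simp [ha, hX]

theorem isEffectivelyClosed_functional (hI : IsTuringIdeal I) :
    IsEffectivelyClosed I {X | ∀ i n m m', X (graphBit i n m) = true →
      X (graphBit i n m') = true → m = m'} := by
  have hi : Primrec fun q : ℕ × ℕ × ℕ × ℕ => q.1 := Primrec.fst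
  have hn : Primrec fun q : ℕ × ℕ × ℕ × ℕ => q.2.1 := Primrec.fst.comp Primrec.snd
  have hm : Primrec fun q : ℕ × ℕ × ℕ × ℕ => q.2.2.1 :=
    Primrec.fst.comp (Primrec.snd.comp Primrec.snd)
  have hm' : Primrec fun q : ℕ × ℕ × ℕ × ℕ => q.2.2.2 :=
    Primrec.snd.comp (Primrec.snd.comp Primrec.snd)
  convert isEffectivelyClosed_of_ite hI
    (.of_primrec hI (PrimrecPred.not (Primrec.eq.comp hm hm')).decide)
    (.of_primrec hI (Primrec.list_cons.comp (primrec_pair_const (primrec_graphBit hi hn hm) false)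
      (primrec_list_singleton (primrec_pair_const (primrec_graphBit hi hn hm') false)))) using 1
  ext X
  simp only [Set.mem_ofPred_eq, Prod.forall]
  refine forall₄_congr fun i n m m' => ?_
  by_cases hmm : m = m' <;> cases h1 : X (graphBit i n m) <;>
    cases h2 : X (graphBit i n m') <;> simp [hmm, h1, h2]

theorem isEffectivelyClosed_injective (hI : IsTuringIdeal I) :
    IsEffectivelyClosed I {X | ∀ i n n' m, X (graphBit i n m) = true →
      X (graphBit i n' m) = true → n = n'} := by
  have hi : Primrec fun q : ℕ × ℕ × ℕ × ℕ => q.1 := Primrec.fst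
  have hn : Primrec fun q : ℕ × ℕ × ℕ × ℕ => q.2.1 := Primrec.fst.comp Primrec.snd
  have hn' : Primrec fun q : ℕ × ℕ × ℕ × ℕ => q.2.2.1 :=
    Primrec.fst.comp (Primrec.snd.comp Primrec.snd)
  have hm : Primrec fun q : ℕ × ℕ × ℕ × ℕ => q.2.2.2 :=
    Primrec.snd.comp (Primrec.snd.comp Primrec.snd)
  convert isEffectivelyClosed_of_ite hI
    (.of_primrec hI (PrimrecPred.not (Primrec.eq.comp hn hn')).decide)
    (.of_primrec hI (Primrec.list_cons.comp (primrec_pair_const (primrec_graphBit hi hn hm) false)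
      (primrec_list_singleton (primrec_pair_const (primrec_graphBit hi hn' hm) false)))) using 1
  ext X
  simp only [Set.mem_ofPred_eq, Prod.forall]
  refine forall₄_congr fun i n n' m => ?_
  by_cases hmm : n = n' <;> cases h1 : X (graphBit i n m) <;>
    cases h2 : X (graphBit i n' m) <;> simp [hmm, h1, h2]

/-- The literals saying that the list `L` is not `[(g 0, g⁻¹ 0), (g 1, g⁻¹ 1), …]` for the `i`-th
permutation `g`. -/
def avoidClause (q : ℕ × List (ℕ × ℕ)) : List (ℕ × Bool) :=
  (List.range q.2.length).flatMap fun k =>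
    [(graphBit q.1 k (q.2.getD k (0, 0)).1, false), (graphBit q.1 (q.2.getD k (0, 0)).2 k, false)]

theorem primrec_avoidClause : Primrec avoidClause := by
  have h1 : Primrec fun p : (ℕ × List (ℕ × ℕ)) × ℕ => p.1.1 := Primrec.fst.comp Primrec.fst
  have h2 : Primrec fun p : (ℕ × List (ℕ × ℕ)) × ℕ => p.1.2.getD p.2 (0, 0) :=
    (Primrec.list_getD _).comp (Primrec.snd.comp Primrec.fst) Primrec.snd
  refine Primrec.list_flatMap (Primrec.list_range.comp (Primrec.list_length.comp Primrec.snd)) ?_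
  exact Primrec.list_cons.comp
    (primrec_pair_const (primrec_graphBit h1 Primrec.snd (Primrec.fst.comp h2)) false)
    (primrec_list_singleton
      (primrec_pair_const (primrec_graphBit h1 (Primrec.snd.comp h2) Primrec.snd) false))

theorem satisfies_avoidClause_iff {y : ℕ → Equiv.Perm ℕ} {i : ℕ} {L : List (ℕ × ℕ)} :
    (∃ l ∈ avoidClause (i, L), graphCode y l.1 = l.2) ↔
      ¬ (L.flatMap fun a => [a.1, a.2]) =
        (List.range L.length).flatMap fun k => [y i k, (y i)⁻¹ k] := by
  have h1 : (∃ l ∈ avoidClause (i, L), graphCode y l.1 = l.2) ↔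
      ¬ ∀ k < L.length, L.getD k (0, 0) = (y i k, (y i)⁻¹ k) := by
    simp only [avoidClause, List.mem_flatMap, List.mem_range, not_forall]
    constructor
    · rintro ⟨l, ⟨k, hk, hl⟩, hl'⟩
      refine ⟨k, hk, fun h => ?_⟩
      rw [h] at hl
      simp only [List.mem_cons, List.not_mem_nil, or_false] at hl
      rcases hl with rfl | rfl <;> simp at hl'
    · rintro ⟨k, hk, h⟩
      by_cases hy : y i k = (L.getD k (0, 0)).1
      · refine ⟨_, ⟨k, hk, List.mem_cons_of_mem _ (List.mem_singleton_self _)⟩, ?_⟩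
        -- Values of the inverse are read off from the graph of `y i` with the arguments exchanged.
        rw [graphCode_graphBit, decide_eq_false_iff_not]
        intro hy'
        exact h (Prod.ext hy.symm (Equiv.Perm.eq_inv_iff_eq.2 hy'))
      · exact ⟨_, ⟨k, hk, List.mem_cons_self⟩, by simpa using hy⟩
  rw [h1, not_iff_not]
  have h2 : (List.range L.length).flatMap (fun k => [y i k, (y i)⁻¹ k]) =
      ((List.range L.length).map fun k => (y i k, (y i)⁻¹ k)).flatMap fun a => [a.1, a.2] := by
    simp [List.flatMap_map]
  have h3 : ∀ L L' : List (ℕ × ℕ), (L.flatMap fun a => [a.1, a.2]) =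
      (L'.flatMap fun a => [a.1, a.2]) ↔ L = L' := by
    intro L
    induction L with
    | nil => intro L'; cases L' <;> simp
    | cons a L ih => intro L'; cases L' <;> simp [ih, Prod.ext_iff, and_assoc]
  rw [h2, h3, List.ext_getElem_iff]
  simp +contextual

/-- A zero of `b` marks a string off the tree, which is to be avoided. The empty list must be
exempt, since its clause is empty and hence unsatisfiable. -/
theorem isEffectivelyClosed_forall_mem_tree (hI : IsTuringIdeal I) {b : ℕ → ℕ}
    (hb : ComputableInIdeal I b) :
    IsEffectivelyClosed I {X | ∀ q : ℕ × List (ℕ × ℕ),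
      (q.2 ≠ [] ∧ b (encode (q.2.flatMap fun a => [a.1, a.2])) = 0) →
        ∃ l ∈ avoidClause q, X l.1 = l.2} := by
  refine isEffectivelyClosed_of_ite hI ?_ (.of_primrec hI primrec_avoidClause)
  have h1 : Primrec fun q : ℕ × List (ℕ × ℕ) => encode (q.2.flatMap fun a => [a.1, a.2]) :=
    Primrec.encode.comp (Primrec.list_flatMap Primrec.snd
      (Primrec.list_cons.comp (Primrec.fst.comp Primrec.snd)
        (primrec_list_singleton (Primrec.snd.comp Primrec.snd))))
  have h2 : Primrec₂ fun (q : ℕ × List (ℕ × ℕ)) (n : ℕ) => decide (q.2 ≠ [] ∧ n = 0) :=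
    (PrimrecPred.and (PrimrecPred.not (Primrec.eq.comp (Primrec.snd.comp Primrec.fst)
      (Primrec.const []))) (Primrec.eq.comp Primrec.snd (Primrec.const 0))).decide
  convert ComputableInIdeal.primrec₂_comp hI h2 (.of_primrec hI Primrec.id)
    (hb.comp hI (.of_primrec hI h1))
  rfl

theorem isEffectivelyClosed_graphCode (hI : IsTuringIdeal I) {G : Subgroup (Equiv.Perm ℕ)}
    (hG : IsCompact (G : Set (Equiv.Perm ℕ)))
    (hbr : ComputableInIdeal I (branching (tree G))) :
    IsEffectivelyClosed I {X | ∃ y : ℕ → G, X = graphCode fun i => y i} := by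
  obtain ⟨h, hh, hGh⟩ := exists_computable_orbit_bound hG hI hbr
  convert (((isEffectivelyClosed_total hI hh).inter hI
    (isEffectivelyClosed_surjective hI hh)).inter hI
    ((isEffectivelyClosed_functional hI).inter hI (isEffectivelyClosed_injective hI))).inter hI
    (isEffectivelyClosed_forall_mem_tree hI hbr) using 1
  have htree (g : Equiv.Perm ℕ) (n : ℕ) : initialString g n =
      ((List.range (n + 1)).map fun k => (g k, g⁻¹ k)).flatMap fun a => [a.1, a.2] := by
    simp [initialString, List.flatMap_map]
  ext X
  constructor
  · rintro ⟨y, rfl⟩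
    -- The bound for `G` also applies to inverses, since `G` is a subgroup.
    refine ⟨⟨⟨fun i n => ⟨(y i).1 n, hGh _ (y i).2 n, by simp⟩, fun i n => ⟨(y i)⁻¹.1 n,
      hGh _ ((y i)⁻¹).2 n, by simp⟩⟩, fun i n m m' => ?_, fun i n n' m => ?_⟩, ?_⟩
    · simp only [graphCode_graphBit, decide_eq_true_iff]
      rintro rfl rfl; rfl
    · simp only [graphCode_graphBit, decide_eq_true_iff]
      rintro rfl h
      exact ((y i).1.injective h).symm
    · rintro ⟨i, L⟩ ⟨hL, hb⟩
      rw [satisfies_avoidClause_iff]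
      intro heq
      rw [branching_encode_eq_zero_iff hG] at hb
      refine hb ⟨y i, (y i).2, L.length - 1, ?_⟩
      rw [heq, initialString, Nat.sub_add_cancel (List.length_pos_iff.2 hL)]
  · rintro ⟨⟨⟨htot, hsurj⟩, hfun, hinj⟩, hmem⟩
    choose f _ hf using htot
    choose g _ hg using hsurj
    let y : ℕ → Equiv.Perm ℕ := fun i =>
      ⟨f i, g i, fun n => hinj _ _ _ _ (hg i _) (hf i n), fun n => hfun _ _ _ _ (hf i _) (hg i n)⟩
    have hX : X = graphCode y := by
      refine eq_graphCode_iff.2 fun i n m => ⟨fun hX => hfun _ _ _ _ (hf i n) hX, ?_⟩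
      rintro rfl
      exact hf i n
    refine ⟨fun i => ⟨y i, mem_of_initialString_mem_tree hG fun n => ?_⟩, hX⟩
    by_contra hn
    have := hmem (i, (List.range (n + 1)).map fun k => (y i k, (y i)⁻¹ k))
      ⟨by simp, by rwa [← htree, branching_encode_eq_zero_iff hG]⟩
    rw [hX, satisfies_avoidClause_iff, ← htree] at this
    simp [initialString] at this

theorem isEffectivelyClosed_implications (hI : IsTuringIdeal I) {α : Type} [Primcodable α]
    {u v w : α → ℕ} (hu : ComputableInIdeal I u) (hv : ComputableInIdeal I v)
    (hw : ComputableInIdeal I w) :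
    IsEffectivelyClosed I {X | ∀ a, X (u a) = true → X (v a) = true → X (w a) = true} := by
  have h1 : Primrec fun q : ℕ × ℕ × ℕ => [(q.1, false), (q.2.1, false), (q.2.2, true)] :=
    Primrec.list_cons.comp (primrec_pair_const Primrec.fst false)
      (Primrec.list_cons.comp (primrec_pair_const (Primrec.fst.comp Primrec.snd) false)
        (primrec_list_singleton (primrec_pair_const (Primrec.snd.comp Primrec.snd) true)))
  refine isEffectivelyClosed_of_clauses hI ((ComputableInIdeal.of_primrec hI h1).comp hI
    (hu.pair hI (hv.pair hI hw))) fun X => forall_congr' fun a => ?_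
  cases h1 : X (u a) <;> cases h2 : X (v a) <;> simp [h1, h2]

/-- A set of sequences of elements of `G` that is effectively closed via the coding of sequences
by their graphs. -/
def IsEffectivelyClosedFamily (I : Set Degree) (G : Subgroup (Equiv.Perm ℕ)) (C : Set (ℕ → G)) :
    Prop :=
  ∃ S, IsEffectivelyClosed I S ∧ ∀ y : ℕ → G, y ∈ C ↔ graphCode (fun i => y i) ∈ S

/-! ### Effectively closed conditions on sequences in `G` -/

namespace IsEffectivelyClosedFamily

variable {G : Subgroup (Equiv.Perm ℕ)}

theorem univ (hI : IsTuringIdeal I) : IsEffectivelyClosedFamily I G Set.univ :=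
  ⟨_, isEffectivelyClosed_univ hI, by simp⟩

theorem inter (hI : IsTuringIdeal I) {C D : Set (ℕ → G)} (hC : IsEffectivelyClosedFamily I G C)
    (hD : IsEffectivelyClosedFamily I G D) : IsEffectivelyClosedFamily I G (C ∩ D) := by
  obtain ⟨S, hS, hCS⟩ := hC
  obtain ⟨T, hT, hDT⟩ := hD
  exact ⟨_, hS.inter hI hT, fun y => by simp [hCS, hDT]⟩

theorem exists_mem (hI : IsScottIdeal I) (hG : IsCompact (G : Set (Equiv.Perm ℕ)))
    (hbr : ComputableInIdeal I (branching (tree G))) {C : Set (ℕ → G)}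
    (hC : IsEffectivelyClosedFamily I G C) (hne : C.Nonempty) :
    ∃ y ∈ C, ∀ i, deg ((y i : Equiv.Perm ℕ) : ℕ → ℕ) ∈ I := by
  have hI' := hI.toIsTuringIdeal
  obtain ⟨S, hS, hCS⟩ := hC
  obtain ⟨y₀, hy₀⟩ := hne
  obtain ⟨_, ⟨⟨y, rfl⟩, hyS⟩, hX⟩ :=
    ((isEffectivelyClosed_graphCode hI' hG hbr).inter hI' hS).exists_mem hI
      ⟨_, ⟨y₀, rfl⟩, (hCS y₀).1 hy₀⟩
  refine ⟨y, (hCS y).2 hyS, fun i => ?_⟩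
  -- A permutation is computed from its graph by searching for the value.
  obtain ⟨g, hg, hg'⟩ := (hX.comp hI' (.of_primrec hI' (primrec_graphBit (Primrec.const i)
    Primrec.fst Primrec.snd))).exists_search hI' fun n => ⟨(y i).1 n, by simp⟩
  convert (computableInIdeal_nat_iff hI').1 hg using 2
  funext n
  simpa using hg' n

theorem mul (hI : IsTuringIdeal I) (i j k : ℕ) :
    IsEffectivelyClosedFamily I G {y | y i = y j * y k} := by
  refine ⟨_, isEffectivelyClosed_implications (α := ℕ × ℕ × ℕ) hI
    (.of_primrec hI (primrec_graphBit (Primrec.const k) Primrec.fst (Primrec.fst.comp Primrec.snd)))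
    (.of_primrec hI (primrec_graphBit (Primrec.const j) (Primrec.fst.comp Primrec.snd)
      (Primrec.snd.comp Primrec.snd)))
    (.of_primrec hI (primrec_graphBit (Primrec.const i) Primrec.fst
      (Primrec.snd.comp Primrec.snd))), fun y => ?_⟩
  simp [Subtype.ext_iff, Equiv.ext_iff]

/-- The condition is that `y j n = m` implies `y i m = n`; the premise is doubled to fit the shape
of `isEffectivelyClosed_implications`. -/
theorem inv (hI : IsTuringIdeal I) (i j : ℕ) :
    IsEffectivelyClosedFamily I G {y | y i = (y j)⁻¹} := by
  have h := primrec_graphBit (α := ℕ × ℕ) (Primrec.const j) Primrec.fst Primrec.snd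
  refine ⟨_, isEffectivelyClosed_implications (α := ℕ × ℕ) hI (.of_primrec hI h)
    (.of_primrec hI h)
    (.of_primrec hI (primrec_graphBit (Primrec.const i) Primrec.snd Primrec.fst)), fun y => ?_⟩
  rw [Set.mem_ofPred_eq, eq_inv_iff_mul_eq_one, ← Subtype.coe_inj, Equiv.ext_iff]
  simp

theorem eq (hI : IsTuringIdeal I) (i j : ℕ) :
    IsEffectivelyClosedFamily I G {y | y i = y j} := by
  have h := primrec_graphBit (α := ℕ × ℕ) (Primrec.const j) Primrec.fst Primrec.snd
  refine ⟨_, isEffectivelyClosed_implications (α := ℕ × ℕ) hI (.of_primrec hI h)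
    (.of_primrec hI h)
    (.of_primrec hI (primrec_graphBit (Primrec.const i) Primrec.fst Primrec.snd)), fun y => ?_⟩
  rw [Set.mem_ofPred_eq, ← Subtype.coe_inj, Equiv.ext_iff]
  simp

theorem eq_const (hI : IsTuringIdeal I) (i : ℕ) {a : G}
    (ha : deg ((a : Equiv.Perm ℕ) : ℕ → ℕ) ∈ I) :
    IsEffectivelyClosedFamily I G {y | y i = a} := by
  have h1 : Primrec₂ fun (n m : ℕ) => [(graphBit i n m, true)] :=
    primrec_list_singleton (primrec_pair_const
      (primrec_graphBit (Primrec.const i) Primrec.fst Primrec.snd) true)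
  refine ⟨{X | ∀ n, X (graphBit i n ((a : Equiv.Perm ℕ) n)) = true},
    isEffectivelyClosed_of_clauses hI (.primrec₂_comp hI h1 (.of_primrec hI Primrec.id)
      ((computableInIdeal_nat_iff hI).2 ha)) fun X => by simp, fun y => ?_⟩
  rw [Set.mem_ofPred_eq, ← Subtype.coe_inj, Equiv.ext_iff]
  simp

theorem apply_eq (hI : IsTuringIdeal I) (i n m : ℕ) :
    IsEffectivelyClosedFamily I G {y | (y i : Equiv.Perm ℕ) n = m} :=
  ⟨{X | X (graphBit i n m) = true}, isEffectivelyClosed_of_clauses (α := ℕ) hI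
    (.of_primrec hI (Primrec.const [(graphBit i n m, true)])) fun X => by simp,
    fun y => by simp⟩

end IsEffectivelyClosedFamily

end

end ScottProfinite

namespace ScottProfinite

open FirstOrder FirstOrder.Language

/-! ### Existential formulas -/

theorem countable_term (α : Type) [Countable α] : Countable (groupLanguage.Term α) := by
  have : Countable (Σ l, groupLanguage.Functions l) := by
    have : Function.Surjective fun i : Fin 3 =>
        (![⟨2, GroupFunc.mul⟩, ⟨1, GroupFunc.inv⟩, ⟨0, GroupFunc.one⟩] i :
          Σ l, groupLanguage.Functions l) := by
      rintro ⟨_, _ | _ | _⟩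
      exacts [⟨0, rfl⟩, ⟨1, rfl⟩, ⟨2, rfl⟩]
    exact this.countable
  infer_instance

section

variable {I : Set Degree} {G : Subgroup (Equiv.Perm ℕ)} {α : Type} {m : ℕ}
  {e : groupLanguage.Term (α ⊕ Fin m) → ℕ}

/-- A sequence in `G`, indexed by terms through `e`, read as an assignment of the variables, the
free ones being interpreted by `a`. -/
def readAssignment (e : groupLanguage.Term (α ⊕ Fin m) → ℕ) (a : α → G) (y : ℕ → G) :
    α ⊕ Fin m → G :=
  Sum.elim a fun i => y (e (.var (.inr i)))

/-- Every subterm has its own coordinate, so evaluating a term amounts to finitely many conditions,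
each relating at most three coordinates. -/
theorem exists_family_term (hI : IsTuringIdeal I) {a : α → G}
    (ha : ∀ j, deg ((a j : Equiv.Perm ℕ) : ℕ → ℕ) ∈ I) {xs : Fin m → G} {y₀ : ℕ → G}
    (hy₀ : ∀ t, y₀ (e t) = t.realize (Sum.elim a xs)) (t : groupLanguage.Term (α ⊕ Fin m)) :
    ∃ C, IsEffectivelyClosedFamily I G C ∧ y₀ ∈ C ∧
      ∀ y ∈ C, y (e t) = t.realize (readAssignment e a y) := by
  induction t with
  | var v =>
    cases v with
    | inl j => exact ⟨_, .eq_const hI (e (.var (.inl j))) (ha j), hy₀ _, fun y hy => hy⟩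
    | inr i => exact ⟨_, .univ hI, trivial, fun y _ => rfl⟩
  | func f ts ih =>
    choose C hC hC₀ hCt using ih
    cases f with
    | mul =>
      refine ⟨_, ((hC 0).inter hI (hC 1)).inter hI
        (.mul hI (e (.func GroupFunc.mul ts)) (e (ts 0)) (e (ts 1))), ⟨⟨hC₀ 0, hC₀ 1⟩, ?_⟩, ?_⟩
      · rw [Set.mem_ofPred_eq, hy₀, hy₀, hy₀]; rfl
      · rintro y ⟨⟨h0, h1⟩, h⟩
        rw [Set.mem_ofPred_eq] at h
        rw [h, hCt 0 y h0, hCt 1 y h1]; rfl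
    | inv =>
      refine ⟨_, (hC 0).inter hI
        (.inv hI (e (.func GroupFunc.inv ts)) (e (ts 0))), ⟨hC₀ 0, ?_⟩, ?_⟩
      · rw [Set.mem_ofPred_eq, hy₀, hy₀]; rfl
      · rintro y ⟨h0, h⟩
        rw [Set.mem_ofPred_eq] at h
        rw [h, hCt 0 y h0]; rfl
    | one =>
      have h1 : deg (((1 : G) : Equiv.Perm ℕ) : ℕ → ℕ) ∈ I :=
        deg_mem_of_primrec hI Nat.Primrec.id
      refine ⟨_, .eq_const hI (e (.func GroupFunc.one ts)) h1, ?_, fun y hy => hy⟩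
      rw [Set.mem_ofPred_eq, hy₀]; rfl

/-- The class freezes the truth value that each atomic subformula has at the given solution, so
connectives need only intersections. -/
theorem exists_family_isQF (hI : IsTuringIdeal I) {a : α → G}
    (ha : ∀ j, deg ((a j : Equiv.Perm ℕ) : ℕ → ℕ) ∈ I) {xs : Fin m → G} {y₀ : ℕ → G}
    (hy₀ : ∀ t, y₀ (e t) = t.realize (Sum.elim a xs)) {φ : groupLanguage.BoundedFormula α m}
    (hφ : φ.IsQF) :
    ∃ C, IsEffectivelyClosedFamily I G C ∧ y₀ ∈ C ∧
      ∀ y ∈ C, (φ.Realize a (fun i => y (e (.var (.inr i)))) ↔ φ.Realize a xs) := by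
  induction hφ with
  | falsum => exact ⟨_, .univ hI, trivial, fun y _ => Iff.rfl⟩
  | of_isAtomic h =>
    cases h with
    | equal t₁ t₂ =>
      obtain ⟨C₁, hC₁, hy₁, h₁⟩ := exists_family_term hI ha hy₀ t₁
      obtain ⟨C₂, hC₂, hy₂, h₂⟩ := exists_family_term hI ha hy₀ t₂
      simp only [Term.bdEqual, BoundedFormula.Realize]
      by_cases heq : t₁.realize (Sum.elim a xs) = t₂.realize (Sum.elim a xs)
      · refine ⟨_, (hC₁.inter hI hC₂).inter hI (.eq hI (e t₁) (e t₂)),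
          ⟨⟨hy₁, hy₂⟩, by rw [Set.mem_ofPred_eq, hy₀, hy₀, heq]⟩, ?_⟩
        rintro y ⟨⟨hy1, hy2⟩, hy⟩
        exact iff_of_true (((h₁ y hy1).symm.trans hy).trans (h₂ y hy2)) heq
      -- Inequality is not a closed condition; fixing both values at a point `n` where they differ
      -- is a closed one that implies it.
      · obtain ⟨n, hn⟩ : ∃ n, (t₁.realize (Sum.elim a xs)).1 n ≠
            (t₂.realize (Sum.elim a xs)).1 n := by
          by_contra! h
          exact heq (Subtype.ext (Equiv.ext h))
        refine ⟨_, (hC₁.inter hI hC₂).inter hI ((IsEffectivelyClosedFamily.apply_eq hI (e t₁) n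
          ((t₁.realize (Sum.elim a xs)).1 n)).inter hI (.apply_eq hI (e t₂) n
          ((t₂.realize (Sum.elim a xs)).1 n))), ⟨⟨hy₁, hy₂⟩, ?_, ?_⟩, ?_⟩
        · rw [Set.mem_ofPred_eq, hy₀]
        · rw [Set.mem_ofPred_eq, hy₀]
        · rintro y ⟨⟨hy1, hy2⟩, hn1, hn2⟩
          refine iff_of_false (fun h => hn ?_) heq
          rw [← hn1, ← hn2, h₁ y hy1, h₂ y hy2]
          exact congrArg (fun g : G => g.1 n) h
    | rel R => exact R.elim
  | imp _ _ ih₁ ih₂ =>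
    obtain ⟨C₁, hC₁, hy₁, h₁⟩ := ih₁
    obtain ⟨C₂, hC₂, hy₂, h₂⟩ := ih₂
    exact ⟨_, hC₁.inter hI hC₂, ⟨hy₁, hy₂⟩, fun y hy => by
      rw [BoundedFormula.realize_imp, BoundedFormula.realize_imp, h₁ y hy.1, h₂ y hy.2]⟩

theorem exists_realize_of_isQF (hI : IsScottIdeal I) (hG : IsCompact (G : Set (Equiv.Perm ℕ)))
    (hbr : ComputableInIdeal I (branching (tree G))) [Countable α]
    (a : α → groupSubstructure (idealSubgroup G I hI.toIsTuringIdeal))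
    {φ : groupLanguage.BoundedFormula α m} (hφ : φ.IsQF) {xs : Fin m → G}
    (h : φ.Realize (fun i => (a i : G)) xs) :
    ∃ xs' : Fin m → groupSubstructure (idealSubgroup G I hI.toIsTuringIdeal),
      φ.Realize a xs' := by
  have := countable_term (α ⊕ Fin m)
  obtain ⟨e, he⟩ := exists_injective_nat (groupLanguage.Term (α ⊕ Fin m))
  let z (t : groupLanguage.Term (α ⊕ Fin m)) : G := t.realize (Sum.elim (fun i => (a i : G)) xs)
  -- The starting sequence lists the values of all terms at `xs`; unused indices get the identity.
  obtain ⟨C, hC, hyC, hCφ⟩ := exists_family_isQF (e := e) hI.toIsTuringIdeal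
    (a := fun i => (a i : G)) (fun j => (a j).2) (xs := xs) (y₀ := Function.extend e z 1)
    (fun t => he.extend_apply z 1 t) hφ
  obtain ⟨y, hy, hyI⟩ := hC.exists_mem hI hG hbr ⟨_, hyC⟩
  refine ⟨fun i => ⟨y (e (.var (.inr i))), hyI _⟩, ?_⟩
  rw [← hφ.realize_embedding (Substructure.subtype _)]
  exact (hCφ y hy).2 h

/-- The values `xs` need not lie in `G_I` and are all replaced at once. Only the parameters `a` stay
fixed, which suffices for a formula with `m = 0`. -/
theorem exists_realize_of_isExistential (hI : IsScottIdeal I)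
    (hG : IsCompact (G : Set (Equiv.Perm ℕ)))
    (hbr : ComputableInIdeal I (branching (tree G))) [Countable α]
    (a : α → groupSubstructure (idealSubgroup G I hI.toIsTuringIdeal))
    {φ : groupLanguage.BoundedFormula α m} (hφ : φ.IsExistential) {xs : Fin m → G}
    (h : φ.Realize (fun i => (a i : G)) xs) :
    ∃ xs' : Fin m → groupSubstructure (idealSubgroup G I hI.toIsTuringIdeal),
      φ.Realize a xs' := by
  induction hφ with
  | of_isQF hφ => exact exists_realize_of_isQF hI hG hbr a hφ h
  | ex _ ih =>
    obtain ⟨z, hz⟩ := BoundedFormula.realize_ex.1 h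
    obtain ⟨xs', h'⟩ := ih hz
    refine ⟨Fin.init xs', BoundedFormula.realize_ex.2 ⟨xs' (Fin.last _), ?_⟩⟩
    rwa [Fin.snoc_init_self]

end

end ScottProfinite

theorem mainTheorem9 (G : Subgroup (Equiv.Perm ℕ)) (hG : ScottProfinite.IsProfinite G)
    (I : Set ScottProfinite.Degree) (hI : ScottProfinite.IsScottIdeal I)
    (hT : ScottProfinite.degTree G ∈ I) :
    ScottProfinite.IsElementarySubstructure
      (ScottProfinite.existentialFormulas ScottProfinite.groupLanguage)
      (ScottProfinite.groupSubstructure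
        (ScottProfinite.idealSubgroup G I hI.toIsTuringIdeal)) := by
  intro n φ hφ a
  have hφ' : FirstOrder.Language.BoundedFormula.IsExistential φ := hφ
  have hbr : ScottProfinite.ComputableInIdeal I (ScottProfinite.branching (ScottProfinite.tree G)) :=
    (ScottProfinite.computableInIdeal_nat_iff hI.toIsTuringIdeal).2
      (hI.mem_of_le _ hT _ le_sup_right)
  constructor
  · intro h
    have := hφ'.realize_embedding (FirstOrder.Language.Substructure.subtype _) h
    -- There is only one assignment of an empty set of bound variables.
    rwa [Subsingleton.elim (_ ∘ default) default] at this
  · intro h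
    obtain ⟨xs', h'⟩ := ScottProfinite.exists_realize_of_isExistential hI hG.isCompact hbr a hφ' h
    rwa [Subsingleton.elim xs' default] at h'
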